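/- Let $(\Omega,\mathcal F,\mathbb P)$ be a probability space and let $X=(X_t)_{t\in\mathbb R_+}$ be a real-valued stochastic process on it. Suppose that $X$ is cadlag (almost surely, its path is right-continuous and has finite left limits) and left-continuous in probability, that is, for every $t>0$, $X_s\to X_t$ in probability as $s\uparrow t$. For a real random variable $Y$, let $\mathrm{supp}(Y)$ be the smallest closed set $F\subseteq\mathbb R$ with $\mathbb P(Y\in F)=1$, and define the marginal support of $X$ by $$\mathrm{MSupp}(X)=\{(t,x)\in\mathbb R_+\times\mathbb R : x\in\mathrm{supp}(X_t)\}.$$ Write $X_{t-}=\lim_{s\uparrow t}X_s$ for $t>0$ and $X_{0-}=X_0$. Then, with probability $1$, $$\{(t,X_{t-}):t\in\mathbb R_+\}\subseteq\mathrm{MSupp}(X).$$ -/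

import Mathlib

open MeasureTheory Filter Topology Set
open scoped NNReal

/-- A path `x : ℝ₊ → ℝ` is cadlag: right-continuous at every time, with a finite left limit at
every time (at `t = 0` the left-limit condition is vacuous). -/
def IsCadlagPath (x : ℝ≥0 → ℝ) : Prop :=
  ∀ t : ℝ≥0, ContinuousWithinAt x (Ici t) t ∧ ∃ l : ℝ, Tendsto x (𝓝[<] t) (𝓝 l)

/-- `X` is left-continuous in probability: `X s → X t` in probability as `s ↑ t`, for every `t`. -/
def LeftContinuousInProbability {Ω : Type*} [MeasurableSpace Ω] (P : Measure Ω)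
    (X : ℝ≥0 → Ω → ℝ) : Prop :=
  ∀ t : ℝ≥0, TendstoInMeasure P X (𝓝[<] t) (X t)

/-- The marginal support of `X`: the pairs `(t, x)` such that `x` is in the support of the law
of `X t`. -/
def marginalSupport {Ω : Type*} [MeasurableSpace Ω] (P : Measure Ω)
    (X : ℝ≥0 → Ω → ℝ) : Set (ℝ≥0 × ℝ) :=
  {p | p.2 ∈ (P.map (X p.1)).support}

/-- The support of the law of a real random variable is the smallest closed set that contains
the variable with probability one. -/
theorem isLeast_support_map {Ω : Type*} [MeasurableSpace Ω] (P : Measure Ω)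
    [IsProbabilityMeasure P] (Y : Ω → ℝ) (hY : Measurable Y) :
    IsLeast {F : Set ℝ | IsClosed F ∧ P (Y ⁻¹' F) = 1} (P.map Y).support := by
  have : IsProbabilityMeasure (P.map Y) := Measure.isProbabilityMeasure_map hY.aemeasurable
  have key : ∀ F : Set ℝ, IsClosed F → (P (Y ⁻¹' F) = 1 ↔ F ∈ ae (P.map Y)) := by
    intro F hF
    rw [← Measure.map_apply hY hF.measurableSet, mem_ae_iff,
      prob_compl_eq_zero_iff hF.measurableSet]
  constructor
  · exact ⟨Measure.isClosed_support,
      (key _ Measure.isClosed_support).2 Measure.support_mem_ae⟩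
  · rintro F ⟨hF, h⟩
    exact Measure.support_subset_of_isClosed hF ((key F hF).1 h)

/-!
The left-limit process `X_{t-}` is left-continuous and, by left-continuity in probability, it is a
modification of `X`; so it suffices that a left-continuous process `Y` almost surely stays in its
marginal support. Fix a closed set `F` and let `S` be the set of times `t` with `Y_t ∈ F` almost
surely. Although `S` may be uncountable, it has a countable subset `D` such that each point of `S`
lies in `D` or is approached by `D` from the left. Almost surely `Y` is in `F` at all times in `D`,
hence, by left-continuity, at all times in `S`. Letting `F` run through the complements of a
countable basis gives the support.
-/

section

variable {T : Type*} [LinearOrder T] [TopologicalSpace T] [OrderTopology T]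
  {Ω : Type*} [MeasurableSpace Ω] {P : Measure Ω}

theorem leftLim_ae_eq_of_tendstoInMeasure [FirstCountableTopology T] {E : Type*} [EMetricSpace E]
    {X : T → Ω → E} {t : T}
    (hlim : ∀ᵐ ω ∂P, ∃ l, Tendsto (fun s => X s ω) (𝓝[<] t) (𝓝 l))
    (hleft : TendstoInMeasure P X (𝓝[<] t) (X t)) :
    (fun ω => Function.leftLim (fun s => X s ω) t) =ᵐ[P] X t := by
  rcases eq_or_neBot (𝓝[<] t) with hbot | _
  · exact ae_of_all _ fun ω => leftLim_eq_of_eq_bot _ hbot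
  obtain ⟨u, hu, hX⟩ := hleft.exists_seq_tendsto_ae'
  filter_upwards [hlim, hX] with ω hωlim hωX
  exact tendsto_nhds_unique ((tendsto_leftLim_of_tendsto hωlim).comp hu) hωX

variable [SecondCountableTopology T]

theorem exists_countable_subset_forall_mem_closure_inter_Iic (S : Set T) :
    ∃ D ⊆ S, D.Countable ∧ ∀ t ∈ S, t ∈ closure (D ∩ Iic t) := by
  obtain ⟨C, hCS, hCcount, hSC⟩ :=
    (TopologicalSpace.IsSeparable.of_separableSpace S).exists_countable_dense_subset
  -- A dense subset of `S` need not approach a time that is isolated from the left in `S`, but there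
  -- are only countably many such times.
  refine ⟨C ∪ {t ∈ S | 𝓝[S ∩ Iio t] t = ⊥}, union_subset hCS (sep_subset _ _),
    hCcount.union countable_setOfPred_isolated_left_within, fun t ht => ?_⟩
  rcases eq_or_neBot (𝓝[S ∩ Iio t] t) with hiso | hlim
  · exact subset_closure ⟨Or.inr ⟨ht, hiso⟩, self_mem_Iic⟩
  have hS_Iio : S ∩ Iio t ⊆ closure (C ∩ Iio t) :=
    (inter_subset_inter_left _ hSC).trans isOpen_Iio.closure_inter
  have ht_closure : t ∈ closure (C ∩ Iio t) :=
    closure_minimal hS_Iio isClosed_closure (mem_closure_iff_nhdsWithin_neBot.2 hlim)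
  exact closure_mono (inter_subset_inter subset_union_left Iio_subset_Iic_self) ht_closure

theorem ae_forall_mem_of_isClosed_of_continuousWithinAt_Iic {E : Type*} [TopologicalSpace E]
    {Y : T → Ω → E}
    (hY : ∀ᵐ ω ∂P, ∀ t, ContinuousWithinAt (fun s => Y s ω) (Iic t) t) {F : Set E}
    (hF : IsClosed F) :
    ∀ᵐ ω ∂P, ∀ t, (∀ᵐ ω' ∂P, Y t ω' ∈ F) → Y t ω ∈ F := by
  obtain ⟨D, hDS, hDcount, hD⟩ :=
    exists_countable_subset_forall_mem_closure_inter_Iic {t | ∀ᵐ ω ∂P, Y t ω ∈ F}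
  have hDF : ∀ᵐ ω ∂P, ∀ t ∈ D, Y t ω ∈ F := (ae_ball_iff hDcount).2 hDS
  filter_upwards [hY, hDF] with ω hcont hωF t ht
  rw [← hF.closure_eq]
  exact ((hcont t).mono inter_subset_right).mem_closure (hD t ht) fun s hs => hωF s hs.1

theorem ae_forall_mem_support_map_of_continuousWithinAt_Iic {E : Type*} [TopologicalSpace E]
    [SecondCountableTopology E] [MeasurableSpace E] [OpensMeasurableSpace E] {Y : T → Ω → E}
    (hYm : ∀ t, AEMeasurable (Y t) P)
    (hY : ∀ᵐ ω ∂P, ∀ t, ContinuousWithinAt (fun s => Y s ω) (Iic t) t) :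
    ∀ᵐ ω ∂P, ∀ t, Y t ω ∈ (P.map (Y t)).support := by
  have hbasis := TopologicalSpace.isBasis_countableBasis E
  have havoid : ∀ᵐ ω ∂P, ∀ U ∈ TopologicalSpace.countableBasis E, ∀ t,
      (∀ᵐ ω' ∂P, Y t ω' ∈ Uᶜ) → Y t ω ∈ Uᶜ :=
    (ae_ball_iff (TopologicalSpace.countable_countableBasis E)).2 fun U hU =>
      ae_forall_mem_of_isClosed_of_continuousWithinAt_Iic hY (hbasis.isOpen hU).isClosed_compl
  filter_upwards [havoid] with ω hω t
  by_contra hsupp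
  obtain ⟨U, ⟨hU, hYU⟩, hU_null⟩ := hbasis.nhds_hasBasis.notMem_measureSupport.1 hsupp
  rw [Measure.map_apply_of_aemeasurable (hYm t) (hbasis.isOpen hU).measurableSet] at hU_null
  exact hω U hU t (measure_eq_zero_iff_ae_notMem.1 hU_null) hYU

theorem mainTheorem7_general {E : Type*} [EMetricSpace E] [SecondCountableTopology E]
    [MeasurableSpace E] [OpensMeasurableSpace E] {X : T → Ω → E} (hX : ∀ t, AEMeasurable (X t) P)
    (hlim : ∀ᵐ ω ∂P, ∀ t, ∃ l, Tendsto (fun s => X s ω) (𝓝[<] t) (𝓝 l))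
    (hleft : ∀ t, TendstoInMeasure P X (𝓝[<] t) (X t)) :
    ∀ᵐ ω ∂P, ∀ t, Function.leftLim (fun s => X s ω) t ∈ (P.map (X t)).support := by
  have hmod (t : T) : (fun ω => Function.leftLim (fun s => X s ω) t) =ᵐ[P] X t :=
    leftLim_ae_eq_of_tendstoInMeasure (hlim.mono fun _ hω => hω t) (hleft t)
  have hcont : ∀ᵐ ω ∂P, ∀ t,
      ContinuousWithinAt (Function.leftLim fun s => X s ω) (Iic t) t :=
    hlim.mono fun _ hω t => continuousWithinAt_leftLim_Iic (tendsto_leftLim_of_tendsto (hω t))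
  filter_upwards [ae_forall_mem_support_map_of_continuousWithinAt_Iic
    (fun t => (hX t).congr (hmod t).symm) hcont] with ω hω t
  exact Measure.map_congr (hmod t) ▸ hω t

end

/-- `Function.leftLim (fun s => X s ω) t` is the left limit `X_{t-}(ω)`, which equals `X_0(ω)`
at `t = 0`. -/
theorem mainTheorem7 {Ω : Type*} [MeasurableSpace Ω] (P : Measure Ω) [IsProbabilityMeasure P]
    (X : ℝ≥0 → Ω → ℝ) (hX : ∀ t, Measurable (X t))
    (hcadlag : ∀ᵐ ω ∂P, IsCadlagPath (fun t => X t ω))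
    (hleft : LeftContinuousInProbability P X) :
    ∀ᵐ ω ∂P, Set.range (fun t : ℝ≥0 => (t, Function.leftLim (fun s => X s ω) t)) ⊆
      marginalSupport P X := by
  filter_upwards [mainTheorem7_general (fun t => (hX t).aemeasurable)
    (hcadlag.mono fun _ hω t => (hω t).2) hleft] with ω hω
  exact range_subset_iff.2 hω
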